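/- **Setting.** Let $S^2\subset\mathbb R^3$ be the unit sphere, $T_qS^2=q^\perp\subset\mathbb R^3$, let $\Pi_q=I-qq^{\top}$, and let $\nabla_XY=\Pi(\mathrm dY(X))$ be the connection induced by the embedding; $\exp$ denotes its geodesic exponential. A *local affine transformation* on an open set $U\subset S^2$ is a diffeomorphism $\psi$ of $U$ onto an open set $\psi(U)$ with $\mathrm d\psi(\nabla_XY)=\nabla_{X'}Y'$ for all $\psi$-related pairs $(X,X'),(Y,Y')$ of smooth vector fields on $U$ and $\psi(U)$. For $a\in\mathbb R^3$ let $a^\times$ be the matrix with $a^\times b=a\times b$. A *system* on $S^2$ with inputs in a finite-dimensional real vector space $V$ assigns to each $u\in V$ a smooth tangent vector field $W^u$; it is a *dynamics* if $(u,q)\mapsto W^u(q)$ is smooth. A *local vector-error representation* consists of an input $t\mapsto u_t\in V$, an $\varepsilon>0$, a non-empty open set $U\subset S^2$ in which any two points are joined by exactly one geodesic segment lying in $U$, and a flow $\Phi^t:U\to S^2$, $|t|<\varepsilon$, with $\Phi^0=\mathrm{id}$ and $\frac{\mathrm d}{\mathrm dt}\Phi^t(p)=W^{u_t}(\Phi^t(p))$.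 For $p,\hat p\in U$ the error vector $\mathfrak{er}(p,\hat p)=v\in T_{\hat p}S^2$ is defined by $\exp_{\hat p}(v)=p$, with the geodesic segment lying in $U$. * The representation has the *exact linearization property* if there are linear maps $B_u$ of $\mathbb R^3$, depending only on $u\in V$, such that for every $\hat p\in U$ there are local affine transformations $\psi^t$ on $U$ with $\psi^t(\hat p)=\Phi^t(\hat p)$, $\Phi^t(p)=\exp_{\Phi^t(\hat p)}\big((\mathrm d\psi^t)_{\hat p}v\big)$ for all $p\in U$, $v=\mathfrak{er}(p,\hat p)$, and such that $F_t=(\mathrm d\psi^t)_{\hat p}$ satisfies $\nabla_tF_t=A_{u_t}F_t$ along $\Phi^t(\hat p)$, where $A_u=\Pi_q B_u|_{T_qS^2}$ on $T_qS^2$. * For $0<T<\varepsilon$ and $p_1,p_2\in U$, a *patch* is a map $H$ on $[0,T]\times[0,1]$ such that for every $t$ the curve $s\mapsto H(t,s)=\exp_{\Phi^t(p_2)}(s\,E_t)$ is a geodesic segment in $U$ from $\Phi^t(p_2)$ to $\Phi^t(p_1)$. The representation is *preintegrable* if on every patch each intermediate curve $t\mapsto H(t,s)$ is again a flow line (a solution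 of $\dot q=W^{u_t}(q)$), and there are diffeomorphisms $\varphi_t$ of $U$ onto open subsets of $S^2$, the same for all patches, with $H(t,s)=\varphi_t(H(0,s))$. The system is *linear observed* if each of its local vector-error representations is preintegrable or has the exact linearization property. **Theorem.** 1. The system $\dot q=-\omega^\times q$ on $S^2$, with input $\omega\in\mathbb R^3$, is a dynamics and is linear observed. 2. A system on $S^2$ with inputs in $V$ is linear observed if and only if there is a function $\sigma:V\to\mathbb R^3$ such that it has the form $\dot q=\sigma(u)^\times q$. Here $\sigma$ may be an arbitrary function. 3. The system $\dot q=\sigma(u)^\times q$ is a dynamics (depends smoothly on $(u,q)$) if and only if $\sigma$ is smooth. Hence the linear observed dynamics are exactly those of the form $\dot q=\sigma(u)^\times q$ with $\sigma$ an arbitrary smooth function. -/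

import Mathlib

open scoped Manifold ContDiff RealInnerProductSpace
open Set

noncomputable section

/-! ### The sphere in Euclidean space and the connection induced by the embedding

Tangent vectors of the sphere at `q` are represented by the vectors of `ℝ³` orthogonal to `q`. -/

/-- Euclidean three-space. -/
abbrev E3 : Type := EuclideanSpace ℝ (Fin 3)

/-- The unit sphere in Euclidean three-space, with Mathlib's manifold structure. -/
abbrev S2 : Type := Metric.sphere (0 : E3) 1

/-- The cross product of `ℝ³`, that is `a^× b`. -/
def cross3 (a b : E3) : E3 := WithLp.toLp 2 (crossProduct a.ofLp b.ofLp)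

/-- The orthogonal projection `1 - q qᵀ` of `ℝ³` onto the tangent plane `T_q S²`. -/
def tangentProj (q : S2) (x : E3) : E3 := x - ⟪(q : E3), x⟫ • (q : E3)

/-- The radial retraction `x ↦ x / ‖x‖` of `ℝ³ ∖ {0}` onto the sphere (with an arbitrary value
at the origin). -/
def radial (x : E3) : S2 :=
  if h : x = 0 then ⟨EuclideanSpace.single 0 1, by simp⟩
  else ⟨‖x‖⁻¹ • x, by simp [norm_smul, h]⟩

/-- The differential at `q` of a map `F` from the sphere to `ℝ³`, applied to a tangent vector
`v ∈ T_q S² ⊂ ℝ³`. It is computed from the extension of `F` which is constant along rays. -/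
def sphereDeriv (F : S2 → E3) (q : S2) (v : E3) : E3 :=
  fderiv ℝ (fun x : E3 => F (radial x)) (q : E3) v

theorem radial_coe (q : S2) : radial (q : E3) = q := by
  have h : (q : E3) ≠ 0 := by
    intro h
    have := norm_eq_of_mem_sphere q
    simp [h] at this
  apply Subtype.ext
  simp [radial, h]

theorem contMDiffAt_radial {x : E3} (hx : x ≠ 0) :
    ContMDiffAt 𝓘(ℝ, E3) (𝓡 2) ∞ radial x := by
  have : Fact (Module.finrank ℝ E3 = 2 + 1) := ⟨finrank_euclideanSpace_fin⟩
  have hc : ContDiffAt ℝ ∞ (fun y : E3 => ‖y‖⁻¹ • y) x :=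
    ((contDiffAt_norm ℝ hx).inv (by simpa using hx)).smul contDiffAt_id
  have he : (fun y : E3 => ((radial y : S2) : E3)) =ᶠ[nhds x] fun y => ‖y‖⁻¹ • y := by
    filter_upwards [isOpen_ne.mem_nhds hx] with y hy
    simp [radial, show y ≠ 0 from hy]
  have hcoe : ContDiffAt ℝ ∞ (fun y : E3 => ((radial y : S2) : E3)) x :=
    hc.congr_of_eventuallyEq he
  rw [contMDiffAt_iff_target]
  refine ⟨Topology.IsEmbedding.subtypeVal.continuousAt_iff.2 hcoe.continuousAt, ?_⟩
  rw [contMDiffAt_iff_contDiffAt]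
  let v := radial x
  let U : _ ≃ₗᵢ[ℝ] _ := (OrthonormalBasis.fromOrthogonalSpanSingleton (𝕜 := ℝ)
        2 (ne_zero_of_mem_unit_sphere (-v))).repr
  have h1 : ContDiffAt ℝ ∞ (fun z => U (stereoToFun ((-v : S2) : E3) z)) (v : E3) := by
    refine (U.contDiff.contDiffAt).comp _ ?_
    refine (contDiffOn_stereoToFun.contDiffAt ?_)
    refine (isOpen_ne_fun (by fun_prop) (by fun_prop)).mem_nhds ?_
    have : ⟪(v : E3), (v : E3)⟫ = 1 := by simp
    simp only [innerSL_apply_apply, ne_eq]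
    change ¬ ⟪(-(v : E3)), (v : E3)⟫ = 1
    rw [inner_neg_left, this]
    norm_num
  have h2 := ContDiffAt.comp (f := fun y : E3 => ((radial y : S2) : E3)) x h1 hcoe
  exact h2

/-- On tangent vectors, `sphereDeriv` is the manifold derivative. -/
theorem sphereDeriv_eq_mfderiv (F : S2 → E3) (q : S2)
    (hF : MDifferentiableAt (𝓡 2) 𝓘(ℝ, E3) F q) (w : TangentSpace (𝓡 2) q) :
    sphereDeriv F q (mfderiv (𝓡 2) 𝓘(ℝ, E3) (fun p : S2 => (p : E3)) q w) =
      mfderiv (𝓡 2) 𝓘(ℝ, E3) F q w := by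
  have : Fact (Module.finrank ℝ E3 = 2 + 1) := ⟨finrank_euclideanSpace_fin⟩
  have h : (q : E3) ≠ 0 := ne_zero_of_mem_unit_sphere q
  have hr := (contMDiffAt_radial h).mdifferentiableAt (by simp)
  have hF' : MDifferentiableAt (𝓡 2) 𝓘(ℝ, E3) F (radial (q : E3)) := by rwa [radial_coe]
  have hc : MDifferentiableAt 𝓘(ℝ, E3) 𝓘(ℝ, E3) (F ∘ radial) (q : E3) := hF'.comp _ hr
  have hi : MDifferentiableAt (𝓡 2) 𝓘(ℝ, E3) (fun p : S2 => (p : E3)) q :=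
    (contMDiff_coe_sphere (m := ∞)).mdifferentiableAt (by simp)
  have e : F = (F ∘ radial) ∘ (fun p : S2 => (p : E3)) := by
    funext p
    simp [radial_coe]
  conv_rhs => rw [e]
  rw [mfderiv_comp q hc hi, mfderiv_eq_fderiv]
  rfl

/-- The differential `(dψ)_q : T_q S² → T_{ψ q} S²` of a map from the sphere to itself. -/
def tangentMapS2 (ψ : S2 → S2) (q : S2) (v : E3) : E3 :=
  sphereDeriv (fun p => (ψ p : E3)) q v

/-- `X` restricts to a smooth (tangent) vector field on the set `U`. -/
def IsVectorFieldOn (X : S2 → E3) (U : Set S2) : Prop :=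
  (∀ q ∈ U, ⟪(q : E3), X q⟫ = 0) ∧ ContMDiffOn (𝓡 2) 𝓘(ℝ, E3) ∞ X U

/-- The connection `∇_X Y` induced by the embedding of the sphere in `ℝ³`: the tangential part of
the derivative of `Y` in the direction of `X`. -/
def nabla (X Y : S2 → E3) (q : S2) : E3 := tangentProj q (sphereDeriv Y q (X q))

/-- The same connection for a vector field `X` along a curve `γ`. -/
def nablaAlong (γ : ℝ → S2) (X : ℝ → E3) (t : ℝ) : E3 := tangentProj (γ t) (deriv X t)

/-- The velocity of a curve on the sphere. -/
def velocity (γ : ℝ → S2) (t : ℝ) : E3 := deriv (fun s => (γ s : E3)) t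

/-- Geodesics, `∇_{γ'} γ' = 0`, with time domain `ℝ` (the sphere is complete). -/
def IsGeodesic (γ : ℝ → S2) : Prop :=
  ContMDiff 𝓘(ℝ, ℝ) (𝓡 2) ∞ γ ∧ ∀ t, nablaAlong γ (velocity γ) t = 0

/-- `exp_p v = q`. -/
def IsExp (p : S2) (v : E3) (q : S2) : Prop :=
  ∃ γ : ℝ → S2, IsGeodesic γ ∧ γ 0 = p ∧ velocity γ 0 = v ∧ γ 1 = q

/-- `ψ` restricts to a diffeomorphism of the open set `U` onto an open subset of the sphere. -/
def IsDiffeoOntoImage (ψ : S2 → S2) (U : Set S2) : Prop :=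
  IsOpen U ∧ IsOpen (ψ '' U) ∧ ContMDiffOn (𝓡 2) (𝓡 2) ∞ ψ U ∧
    ∃ χ : S2 → S2, ContMDiffOn (𝓡 2) (𝓡 2) ∞ χ (ψ '' U) ∧ ∀ q ∈ U, χ (ψ q) = q

/-- The vector fields `X` on `U` and `X'` on `ψ '' U` are `ψ`-related. -/
def AreRelatedOn (ψ : S2 → S2) (U : Set S2) (X X' : S2 → E3) : Prop :=
  IsVectorFieldOn X U ∧ IsVectorFieldOn X' (ψ '' U) ∧
    ∀ q ∈ U, tangentMapS2 ψ q (X q) = X' (ψ q)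

/-- `ψ` is a local affine transformation on `U`: a diffeomorphism of `U` onto `ψ '' U` that
preserves the connection. -/
def IsLocalAffine (ψ : S2 → S2) (U : Set S2) : Prop :=
  IsDiffeoOntoImage ψ U ∧
    ∀ X Y X' Y' : S2 → E3, AreRelatedOn ψ U X X' → AreRelatedOn ψ U Y Y' →
      ∀ q ∈ U, tangentMapS2 ψ q (nabla X Y q) = nabla X' Y' (ψ q)

/-! ### Vector-error representations -/

/-- The error relation `er(q, p) = v` of `U`: `exp_p v = q`, along a geodesic which stays
in `U`. -/
def IsErr (U : Set S2) (q p : S2) (v : E3) : Prop :=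
  ∃ γ : ℝ → S2, IsGeodesic γ ∧ γ 0 = p ∧ velocity γ 0 = v ∧ γ 1 = q ∧ ∀ s ∈ Icc (0 : ℝ) 1, γ s ∈ U

/-- `U` is a normal neighbourhood in which any two points are joined by exactly one geodesic
segment of `U`; so `IsErr U` is the graph of the error function `U × U → TS²`. -/
def IsNormalNbhd (U : Set S2) : Prop :=
  IsOpen U ∧ U.Nonempty ∧ ∀ p ∈ U, ∀ q ∈ U, ∃! v : E3, IsErr U q p v

/-- A control system on the sphere: to every input `u` a smooth tangent vector field `field u`. -/
structure ControlSystem (V : Type*) where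
  field : V → S2 → E3
  isVectorField : ∀ u, IsVectorFieldOn (field u) univ

namespace ControlSystem

variable {V : Type*}

/-- The vector field depends smoothly on the input: the system is a smooth map `V → Γ(TS²)`. -/
def IsSmooth [NormedAddCommGroup V] [NormedSpace ℝ V] (f : ControlSystem V) : Prop :=
  ContMDiff (𝓘(ℝ, V).prod (𝓡 2)) 𝓘(ℝ, E3) ∞ (fun x : V × S2 => f.field x.1 x.2)

/-- `(Φ, u)` on the normal neighbourhood `U` is a local vector-error representation of `f`: for
`p ∈ U` the curve `t ↦ Φ t p`, `|t| < ε`, is the integral curve from `p` of the time-dependent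
vector field `f.field (u t)`. The error function is the one of `U`. (That `Φ t` is a
diffeomorphism of `U` onto its image is not required separately: it is a consequence of
the smooth dependence of solutions of differential equations on their initial values.) -/
structure IsVectorErrorRep (f : ControlSystem V) (u : ℝ → V) (ε : ℝ) (U : Set S2)
    (Φ : ℝ → S2 → S2) : Prop where
  pos : 0 < ε
  normal : IsNormalNbhd U
  initial : ∀ p ∈ U, Φ 0 p = p
  integral : ∀ p ∈ U, ∀ t ∈ Ioo (-ε) ε,
    HasDerivAt (fun τ => (Φ τ p : E3)) (f.field (u t) (Φ t p)) t

/-- Exact linearization independent of the state. For every estimate `p̂ ∈ U` there are local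
affine transformations `ψ t` of `U` such that `Φ t p = exp_{Φ t p̂} ((dψ t)_p̂ v)` when `v` is the
error vector of `p` at `p̂`, and `F t = (dψ t)_p̂ : T_p̂ S² → T_{Φ t p̂} S²` solves
`∇_t F t = A_{u t} F t`. Here `A_u`, the endomorphism of the tangent planes, is induced by
a linear map `B u` of `ℝ³` which depends on the value of the input only. -/
def ExactLinearization (u : ℝ → V) (ε : ℝ) (U : Set S2) (Φ : ℝ → S2 → S2) : Prop :=
  ∃ B : V → E3 →ₗ[ℝ] E3, ∀ p' ∈ U, ∃ ψ : ℝ → S2 → S2,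
    (∀ t ∈ Ioo (-ε) ε, IsLocalAffine (ψ t) U ∧ ψ t p' = Φ t p' ∧
      ∀ p ∈ U, ∀ v, IsErr U p p' v → IsExp (Φ t p') (tangentMapS2 (ψ t) p' v) (Φ t p)) ∧
    ∀ v : E3, ⟪(p' : E3), v⟫ = 0 → ∀ t ∈ Ioo (-ε) ε,
      DifferentiableAt ℝ (fun τ => tangentMapS2 (ψ τ) p' v) t ∧
      nablaAlong (fun τ => Φ τ p') (fun τ => tangentMapS2 (ψ τ) p' v) t =
        tangentProj (Φ t p') (B (u t) (tangentMapS2 (ψ t) p' v))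

/-- `H`, restricted to `[0, T] × [0, 1]`, is the patch between the flow lines of `p₂` and `p₁`:
for every `t` the curve `s ↦ H t s` is the geodesic of `U` from `Φ t p₂` to `Φ t p₁`,
that is `H t s = exp_{Φ t p₂} (s E)` with `E` the error vector of `Φ t p₁` at `Φ t p₂`. (The field
`∂H/∂s` is then parallel along these geodesics.) -/
def IsPatch (U : Set S2) (Φ : ℝ → S2 → S2) (T : ℝ) (p₁ p₂ : S2) (H : ℝ → ℝ → S2) : Prop :=
  ∀ t ∈ Icc 0 T, ∃ γ : ℝ → S2, IsGeodesic γ ∧ γ 0 = Φ t p₂ ∧ γ 1 = Φ t p₁ ∧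
    ∀ s ∈ Icc (0 : ℝ) 1, γ s ∈ U ∧ H t s = γ s

/-- The flow field is self-similar: the intermediate curves `t ↦ H t s` of every patch are again
flow lines. -/
def SelfSimilar (f : ControlSystem V) (u : ℝ → V) (ε : ℝ) (U : Set S2) (Φ : ℝ → S2 → S2) : Prop :=
  ∀ T ∈ Ioo 0 ε, ∀ p₁ ∈ U, ∀ p₂ ∈ U, ∀ H : ℝ → ℝ → S2, IsPatch U Φ T p₁ p₂ H →
    ∀ s ∈ Icc (0 : ℝ) 1, ∀ t ∈ Icc 0 T,
      HasDerivWithinAt (fun τ => (H τ s : E3)) (f.field (u t) (H t s)) (Icc 0 T) t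

/-- Preintegrability: the flow field is self-similar, and all patches are moved by one family of
transformations `φ t`, calculated in advance for all starting points: `H t s = φ t (H 0 s)`. -/
def Preintegrable (f : ControlSystem V) (u : ℝ → V) (ε : ℝ) (U : Set S2) (Φ : ℝ → S2 → S2) :
    Prop :=
  f.SelfSimilar u ε U Φ ∧
    ∃ φ : ℝ → S2 → S2, (∀ t ∈ Ioo (-ε) ε, IsDiffeoOntoImage (φ t) U) ∧
      ∀ T ∈ Ioo 0 ε, ∀ p₁ ∈ U, ∀ p₂ ∈ U, ∀ H : ℝ → ℝ → S2, IsPatch U Φ T p₁ p₂ H →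
        ∀ t ∈ Icc 0 T, ∀ s ∈ Icc (0 : ℝ) 1, H t s = φ t (H 0 s)

/-- A system is linear observed if each of its local vector-error representations is
preintegrable or possesses the exact linearization property. -/
def LinearObserved (f : ControlSystem V) : Prop :=
  ∀ (u : ℝ → V) (ε : ℝ) (U : Set S2) (Φ : ℝ → S2 → S2), f.IsVectorErrorRep u ε U Φ →
    f.Preintegrable u ε U Φ ∨ ExactLinearization u ε U Φ

end ControlSystem

/-- Smoothness and tangency of the linear vector field `q ↦ a × q`. -/
theorem isVectorFieldOn_cross3 (a : E3) : IsVectorFieldOn (fun q => cross3 a q) univ := by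
  refine ⟨fun q _ => ?_, ?_⟩
  · simp only [cross3, EuclideanSpace.inner_eq_star_dotProduct, star_trivial]
    rw [dotProduct_comm]
    exact dot_cross_self _ _
  · have : Fact (Module.finrank ℝ E3 = 2 + 1) := ⟨finrank_euclideanSpace_fin⟩
    let L : E3 →ₗ[ℝ] E3 := (WithLp.linearEquiv 2 ℝ (Fin 3 → ℝ)).symm.toLinearMap ∘ₗ
      crossProduct a.ofLp ∘ₗ (WithLp.linearEquiv 2 ℝ (Fin 3 → ℝ)).toLinearMap
    exact (L.toContinuousLinearMap.contDiff.contMDiff.comp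
      (contMDiff_coe_sphere (n := 2))).contMDiffOn

/-- The system `q̇ = σ(u)^× q`. -/
def rotationSystem {V : Type*} (σ : V → E3) : ControlSystem V where
  field u q := cross3 (σ u) q
  isVectorField u := isVectorFieldOn_cross3 (σ u)

/-- The system `q̇ = -w^× q` of the partial attitude estimator; the input is the angular
velocity `w ∈ ℝ³`. -/
def attitudeSystem : ControlSystem E3 where
  field w q := -cross3 w q
  isVectorField w := by
    have h := isVectorFieldOn_cross3 (-w)
    have e : (fun q : S2 => cross3 (-w) q) = fun q : S2 => -cross3 w q := by
      funext q
      simp only [cross3, WithLp.ofLp_neg, map_neg, LinearMap.neg_apply, WithLp.toLp_neg]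
    rwa [e] at h

end

/-! ### Geodesics of the sphere -/

/-! Rotation fields are linear observed because their flows are restrictions of linear isometries `R
t` of space (`exists_linear_flow`). Isometries preserve the connection and commute with `exp`, and
`R t` solves `R' = σ(u)^× R`, so exact linearization holds with `B u = σ(u)^×`
(`exactLinearization_rotationSystem`).

Conversely, constant inputs suffice. Every point has a representation with constant input
(`exists_isVectorErrorRep`), and either property makes the flow carry midpoints of geodesics to
midpoints. If `M` is the midpoint of `P` and `Q`, then `P + Q` is a multiple of `M`. Differentiating
this at time zero gives a relation between the values of the field `W` at the three points (the two
`exists_midpoint` lemmas). Along a great circle `c`, it says that `k = ⟪W(c), c'⟫` has vanishing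
second symmetric differences. So `k` is affine, and being periodic it is constant
(`inner_unitCircle_const`), which is the Killing property of `W`. Comparing `k` at two points yields
`⟪W p, q⟫ = -⟪W q, p⟫` (`inner_field_skew`), so `W` is given by a skew matrix, that is, by a cross
product.

Smoothness in the input is read off from the values of the field on the standard basis. -/

theorem inner_coe_self (q : S2) : ⟪(q : E3), (q : E3)⟫ = 1 := by simp

theorem norm_coe_S2 (q : S2) : ‖(q : E3)‖ = 1 := norm_eq_of_mem_sphere q

theorem radial_of_norm_eq_one {x : E3} (hx : ‖x‖ = 1) : ((radial x : S2) : E3) = x := by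
  have h0 : x ≠ 0 := by
    rintro rfl
    simp at hx
  simp [radial, h0, hx]

theorem coe_radial {x : E3} (hx : x ≠ 0) : ((radial x : S2) : E3) = ‖x‖⁻¹ • x := by
  simp [radial, hx]

theorem continuousAt_radial {x : E3} (hx : x ≠ 0) : ContinuousAt radial x :=
  (contMDiffAt_radial hx).continuousAt

/-- A solution of `y'' = -c² y` which vanishes to first order at `0` is zero. -/
theorem eq_zero_of_harmonic {y y' : ℝ → E3} {c : ℝ} (h1 : ∀ t, HasDerivAt y (y' t) t)
    (h2 : ∀ t, HasDerivAt y' (-(c ^ 2) • y t) t) (h0 : y 0 = 0) (h0' : y' 0 = 0) (t : ℝ) :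
    y t = 0 := by
  -- The energy is conserved. Only `y' = 0` is extracted from its vanishing, because `c` may be
  -- zero.
  have hE : ∀ t, HasDerivAt (fun t => ⟪y' t, y' t⟫ + c ^ 2 * ⟪y t, y t⟫) 0 t := by
    intro t
    refine (((h2 t).inner ℝ (h2 t)).add (((h1 t).inner ℝ (h1 t)).const_mul (c ^ 2))).congr_deriv ?_
    simp only [inner_smul_left, inner_smul_right, real_inner_comm (y t) (y' t)]
    simp
    ring
  have hc : ∀ t, ⟪y' t, y' t⟫ + c ^ 2 * ⟪y t, y t⟫ = 0 := by
    intro t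
    have := is_const_of_deriv_eq_zero (fun t => (hE t).differentiableAt) (fun t => (hE t).deriv) t 0
    simpa [h0, h0'] using this
  have hy' : ∀ t, y' t = 0 := by
    intro t
    have h3 := hc t
    have h4 : 0 ≤ ⟪y' t, y' t⟫ := real_inner_self_nonneg
    have h5 : 0 ≤ c ^ 2 * ⟪y t, y t⟫ := mul_nonneg (sq_nonneg _) real_inner_self_nonneg
    exact inner_self_eq_zero.1 (by linarith : ⟪y' t, y' t⟫ = 0)
  have := is_const_of_deriv_eq_zero (fun t => (h1 t).differentiableAt)
    (fun t => by rw [(h1 t).deriv, hy' t]) t 0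
  rw [this, h0]

theorem inner_hasDerivAt_of_norm_eq_one {c : ℝ → S2} {c' : E3} {t : ℝ}
    (h : HasDerivAt (fun s => (c s : E3)) c' t) : ⟪(c t : E3), c'⟫ = 0 := by
  have h1 := h.inner ℝ h
  have h2 : (fun s => ⟪(c s : E3), (c s : E3)⟫) = fun _ => (1 : ℝ) := by
    funext s
    exact inner_coe_self _
  rw [h2] at h1
  have h3 := h1.unique (hasDerivAt_const t (1 : ℝ))
  rw [real_inner_comm (c t : E3) c'] at h3
  linarith

theorem IsGeodesic.contDiff {γ : ℝ → S2} (h : IsGeodesic γ) :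
    ContDiff ℝ ∞ (fun t => (γ t : E3)) := by
  have : Fact (Module.finrank ℝ E3 = 2 + 1) := ⟨finrank_euclideanSpace_fin⟩
  exact ((contMDiff_coe_sphere (m := ∞)).comp h.1).contDiff

theorem IsGeodesic.hasDerivAt {γ : ℝ → S2} (h : IsGeodesic γ) (t : ℝ) :
    HasDerivAt (fun t => (γ t : E3)) (velocity γ t) t :=
  (h.contDiff.differentiable (by simp)).differentiableAt.hasDerivAt

theorem IsGeodesic.inner_velocity {γ : ℝ → S2} (h : IsGeodesic γ) (t : ℝ) :
    ⟪(γ t : E3), velocity γ t⟫ = 0 :=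
  inner_hasDerivAt_of_norm_eq_one (h.hasDerivAt t)

/-- The acceleration is normal to the sphere. Differentiating `⟪γ, γ'⟫ = 0` gives its normal
component `-‖γ'‖²`, and the speed is constant because the acceleration is orthogonal to the
velocity. -/
theorem IsGeodesic.hasDerivAt_velocity {γ : ℝ → S2} (h : IsGeodesic γ) (t : ℝ) :
    HasDerivAt (velocity γ) (-(‖velocity γ 0‖ ^ 2) • (γ t : E3)) t := by
  have hd : ∀ t, HasDerivAt (velocity γ) (deriv (velocity γ) t) t := by
    intro t
    have h1 : ContDiff ℝ ∞ (velocity γ) := (contDiff_infty_iff_deriv.1 h.contDiff).2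
    exact (h1.differentiable (by simp)).differentiableAt.hasDerivAt
  have hi : ∀ t, ⟪(γ t : E3), deriv (velocity γ) t⟫ + ⟪velocity γ t, velocity γ t⟫ = 0 := by
    intro t
    have h1 := (h.hasDerivAt t).inner ℝ (hd t)
    have h2 : (fun s => ⟪(γ s : E3), velocity γ s⟫) = fun _ => (0 : ℝ) := by
      funext s
      exact h.inner_velocity s
    rw [h2] at h1
    exact h1.unique (hasDerivAt_const t (0 : ℝ))
  have hg : ∀ t, deriv (velocity γ) t = -⟪velocity γ t, velocity γ t⟫ • (γ t : E3) := by
    intro t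
    have h1 := h.2 t
    rw [nablaAlong, tangentProj, sub_eq_zero] at h1
    rw [h1, eq_neg_of_add_eq_zero_left (hi t)]
  have hc : ⟪velocity γ t, velocity γ t⟫ = ⟪velocity γ 0, velocity γ 0⟫ := by
    have h1 : ∀ t, HasDerivAt (fun s => ⟪velocity γ s, velocity γ s⟫) 0 t := by
      intro t
      refine ((hd t).inner ℝ (hd t)).congr_deriv ?_
      rw [hg t, inner_smul_left, inner_smul_right, 
        real_inner_comm (γ t : E3) (velocity γ t), h.inner_velocity t]
      simp
    exact is_const_of_deriv_eq_zero (fun t => (h1 t).differentiableAt)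
      (fun t => (h1 t).deriv) t 0
  have h3 := hd t
  rwa [hg t, hc, real_inner_self_eq_norm_sq] at h3

/-- The great circle through `p` with initial velocity `v`, as a curve in space. -/
noncomputable def greatCircle (p v : E3) (t : ℝ) : E3 :=
  Real.cos (‖v‖ * t) • p + (Real.sin (‖v‖ * t) * ‖v‖⁻¹) • v

theorem hasDerivAt_greatCircle (p v : E3) (t : ℝ) :
    HasDerivAt (greatCircle p v) (-(‖v‖ * Real.sin (‖v‖ * t)) • p + Real.cos (‖v‖ * t) • v) t := by
  have hl : HasDerivAt (fun t => ‖v‖ * t) ‖v‖ t := by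
    simpa using (hasDerivAt_id t).const_mul ‖v‖
  refine ((hl.cos.smul_const p).add ((hl.sin.mul_const ‖v‖⁻¹).smul_const v)).congr_deriv ?_
  congr 1
  · congr 1; ring
  -- For `v = 0` the value `‖v‖⁻¹ = 0` multiplies `v` itself, so one formula also covers constant
  -- geodesics.
  · rcases eq_or_ne v 0 with rfl | hv
    · simp
    · rw [mul_assoc, mul_inv_cancel₀ (norm_ne_zero_iff.2 hv), mul_one]

theorem hasDerivAt_deriv_greatCircle (p v : E3) (t : ℝ) :
    HasDerivAt (fun t => -(‖v‖ * Real.sin (‖v‖ * t)) • p + Real.cos (‖v‖ * t) • v)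
      (-(‖v‖ ^ 2) • greatCircle p v t) t := by
  have hl : HasDerivAt (fun t => ‖v‖ * t) ‖v‖ t := by
    simpa using (hasDerivAt_id t).const_mul ‖v‖
  refine (((hl.sin.const_mul ‖v‖).neg.smul_const p).add (hl.cos.smul_const v)).congr_deriv ?_
  rw [greatCircle, smul_add, smul_smul, smul_smul]
  congr 1
  · congr 1; ring
  · rcases eq_or_ne v 0 with rfl | hv
    · simp
    · congr 1
      field_simp

theorem IsGeodesic.coe_eq {γ : ℝ → S2} (h : IsGeodesic γ) (t : ℝ) :
    (γ t : E3) = greatCircle (γ 0) (velocity γ 0) t := by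
  refine sub_eq_zero.1 (eq_zero_of_harmonic (c := ‖velocity γ 0‖)
    (fun t => (h.hasDerivAt t).sub (hasDerivAt_greatCircle _ _ t))
    (fun t => ((h.hasDerivAt_velocity t).sub (hasDerivAt_deriv_greatCircle _ _ t)).congr_deriv ?_)
    ?_ ?_ t)
  · rw [Pi.sub_apply, smul_sub]
  · simp [greatCircle]
  · simp

theorem norm_greatCircle {p v : E3} (hp : ‖p‖ = 1) (hv : ⟪p, v⟫ = 0) (t : ℝ) :
    ‖greatCircle p v t‖ = 1 := by
  have h : ‖greatCircle p v t‖ ^ 2 = 1 := by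
    rw [← real_inner_self_eq_norm_sq, greatCircle]
    simp only [inner_add_left, inner_add_right, inner_smul_left, inner_smul_right,
      real_inner_comm p v, hv, real_inner_self_eq_norm_sq, hp]
    rcases eq_or_ne v 0 with rfl | h0
    · simp
    · have := norm_ne_zero_iff.2 h0
      simp
      field_simp
      linarith [Real.sin_sq_add_cos_sq (‖v‖ * t)]
  nlinarith [norm_nonneg (greatCircle p v t)]

theorem exists_isGeodesic (p : S2) {v : E3} (hv : ⟪(p : E3), v⟫ = 0) :
    ∃ γ : ℝ → S2, IsGeodesic γ ∧ γ 0 = p ∧ velocity γ 0 = v ∧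
      ∀ t, (γ t : E3) = greatCircle p v t := by
  have : Fact (Module.finrank ℝ E3 = 2 + 1) := ⟨finrank_euclideanSpace_fin⟩
  have hs : ∀ t, greatCircle p v t ∈ Metric.sphere (0 : E3) 1 := fun t => by
    simpa using norm_greatCircle (norm_coe_S2 p) hv t
  have hc : ContDiff ℝ ∞ (greatCircle p v) := by
    unfold greatCircle
    fun_prop
  have hd : deriv (greatCircle p v) = fun t =>
      -(‖v‖ * Real.sin (‖v‖ * t)) • (p : E3) + Real.cos (‖v‖ * t) • v :=
    funext fun t => (hasDerivAt_greatCircle (p : E3) v t).deriv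
  have hvel : velocity (Set.codRestrict (greatCircle p v) _ hs) = fun t =>
      -(‖v‖ * Real.sin (‖v‖ * t)) • (p : E3) + Real.cos (‖v‖ * t) • v := hd
  refine ⟨Set.codRestrict (greatCircle p v) _ hs,
    ⟨hc.contMDiff.codRestrict_sphere hs, fun t => ?_⟩, ?_, ?_, fun t => rfl⟩
  · rw [nablaAlong, hvel, (hasDerivAt_deriv_greatCircle (p : E3) v t).deriv, tangentProj,
      val_codRestrict_apply, inner_smul_right, real_inner_self_eq_norm_sq,
      norm_greatCircle (norm_coe_S2 p) hv t]
    simp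
  · apply Subtype.ext
    simp [greatCircle]
  · rw [hvel]
    simp

theorem IsExp.inner_eq_zero {p q : S2} {v : E3} (h : IsExp p v q) : ⟪(p : E3), v⟫ = 0 := by
  obtain ⟨γ, hγ, rfl, rfl, -⟩ := h
  exact hγ.inner_velocity 0

theorem IsExp.coe_eq {p q : S2} {v : E3} (h : IsExp p v q) : (q : E3) = greatCircle p v 1 := by
  obtain ⟨γ, hγ, rfl, rfl, rfl⟩ := h
  exact hγ.coe_eq 1

theorem isExp_of_coe_eq {p q : S2} {v : E3} (hv : ⟪(p : E3), v⟫ = 0)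
    (hq : (q : E3) = greatCircle p v 1) : IsExp p v q := by
  obtain ⟨γ, hγ, h0, h1, h2⟩ := exists_isGeodesic p hv
  exact ⟨γ, hγ, h0, h1, Subtype.ext (by rw [h2, hq])⟩

/-! ### Rotations -/

/-- The cross product as a linear map of the second factor. -/
def cross3Linear (a : E3) : E3 →ₗ[ℝ] E3 where
  toFun := cross3 a
  map_add' x y := by simp [cross3]
  map_smul' c x := by simp [cross3]

@[simp] theorem cross3Linear_apply (a x : E3) : cross3Linear a x = cross3 a x := rfl

theorem inner_cross3_self (a x : E3) : ⟪x, cross3 a x⟫ = 0 := by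
  simp only [cross3, EuclideanSpace.inner_eq_star_dotProduct, star_trivial]
  rw [dotProduct_comm]
  exact dot_cross_self _ _

/-- Serves to show that flows are isometric, unique and confined to the sphere. No regularity of
`y'` in time is needed, which matters since inputs are arbitrary functions of time. -/
theorem norm_eq_of_inner_deriv_eq_zero {y y' : ℝ → E3} {ε : ℝ} (hε : 0 < ε)
    (hy : ∀ t ∈ Ioo (-ε) ε, HasDerivAt y (y' t) t) (h : ∀ t ∈ Ioo (-ε) ε, ⟪y t, y' t⟫ = 0)
    {t : ℝ} (ht : t ∈ Ioo (-ε) ε) : ‖y t‖ = ‖y 0‖ := by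
  have hd : ∀ t ∈ Ioo (-ε) ε, HasDerivAt (fun t => ⟪y t, y t⟫) 0 t := by
    intro t ht
    refine ((hy t ht).inner ℝ (hy t ht)).congr_deriv ?_
    rw [real_inner_comm (y t) (y' t), h t ht, add_zero]
  have h0 : (0 : ℝ) ∈ Ioo (-ε) ε := ⟨by linarith, hε⟩
  have := isOpen_Ioo.is_const_of_deriv_eq_zero isPreconnected_Ioo
    (fun t ht => (hd t ht).differentiableAt.differentiableWithinAt)
    (fun t ht => (hd t ht).deriv) ht h0
  simp only [real_inner_self_eq_norm_sq] at this
  exact (pow_left_inj₀ (norm_nonneg _) (norm_nonneg _) two_ne_zero).1 this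

/-- The span contains the cone over `U`, hence a neighbourhood of a point, and a subspace with
interior is everything. -/
theorem span_coe_eq_top_of_isOpen {U : Set S2} (hU : IsOpen U) (hne : U.Nonempty) :
    Submodule.span ℝ ((fun q : S2 => (q : E3)) '' U) = ⊤ := by
  obtain ⟨p, hp⟩ := hne
  refine Submodule.eq_top_of_nonempty_interior' _ ⟨(p : E3), ?_⟩
  have hp0 : (p : E3) ≠ 0 := ne_zero_of_mem_unit_sphere p
  have h1 : ∀ᶠ x in nhds (p : E3), radial x ∈ U :=
    (continuousAt_radial hp0).eventually_mem (hU.mem_nhds (by rwa [radial_coe]))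
  refine mem_interior_iff_mem_nhds.2 ?_
  filter_upwards [h1, isOpen_ne.mem_nhds hp0] with x hx hx0
  have h2 : x = ‖x‖ • ((radial x : S2) : E3) := by
    rw [coe_radial hx0, smul_smul, mul_inv_cancel₀ (norm_ne_zero_iff.2 hx0), one_smul]
  rw [h2]
  exact Submodule.smul_mem _ _ (Submodule.subset_span ⟨_, hx, rfl⟩)

/-- The flow of a rotation system is the restriction of linear isometries. -/
theorem exists_linear_flow {V : Type*} {σ : V → E3} {u : ℝ → V} {ε : ℝ} {U : Set S2}
    {Φ : ℝ → S2 → S2} (h : (rotationSystem σ).IsVectorErrorRep u ε U Φ) :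
    ∃ R : ℝ → E3 →ₗ[ℝ] E3,
      (∀ x, ∀ t ∈ Ioo (-ε) ε, HasDerivAt (fun τ => R τ x) (cross3 (σ (u t)) (R t x)) t) ∧
      (∀ t ∈ Ioo (-ε) ε, ∀ x, ‖R t x‖ = ‖x‖) ∧
      ∀ t ∈ Ioo (-ε) ε, ∀ p ∈ U, (Φ t p : E3) = R t p := by
  have hint : ∀ p ∈ U, ∀ t ∈ Ioo (-ε) ε,
    HasDerivAt (fun τ => (Φ τ p : E3)) (cross3 (σ (u t)) (Φ t p)) t := h.integral
  have hs := span_coe_eq_top_of_isOpen h.normal.1 h.normal.2.1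
  let b := Module.Basis.ofSpan hs.ge
  have hb : ∀ i, ∃ q ∈ U, (q : E3) = b i := fun i => by
    have h1 := Module.Basis.ofSpan_subset hs.ge (mem_range_self i)
    exact h1
  choose q hqU hq using hb
  have : Fintype _ := FiniteDimensional.fintypeBasisIndex b
  -- The linear flow is determined by transporting a basis of space made of points of `U`.
  let R : ℝ → E3 →ₗ[ℝ] E3 := fun t => b.constr ℝ fun i => (Φ t (q i) : E3)
  have hR : ∀ t x, R t x = ∑ i, b.repr x i • (Φ t (q i) : E3) := fun t x => by
    rw [Module.Basis.constr_apply_fintype]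
    rfl
  have hR0 : ∀ x, R 0 x = x := fun x => by
    rw [hR]
    conv_rhs => rw [← b.sum_repr x]
    exact Finset.sum_congr rfl fun i _ => by rw [h.initial _ (hqU i), hq]
  have hd : ∀ x, ∀ t ∈ Ioo (-ε) ε,
      HasDerivAt (fun τ => R τ x) (cross3 (σ (u t)) (R t x)) t := by
    intro x t ht
    have h1 : HasDerivAt (fun τ => ∑ i, b.repr x i • (Φ τ (q i) : E3))
        (∑ i, b.repr x i • cross3 (σ (u t)) (Φ t (q i))) t :=
      HasDerivAt.fun_sum fun i _ => (hint _ (hqU i) t ht).fun_const_smul _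
    simp only [hR]
    refine h1.congr_deriv ?_
    rw [← cross3Linear_apply, map_sum]
    simp
  refine ⟨R, hd, fun t ht x => ?_, fun t ht p hp => ?_⟩
  · have := norm_eq_of_inner_deriv_eq_zero h.pos (hd x) (fun t _ => inner_cross3_self _ _) ht
    rwa [hR0] at this
  -- Uniqueness: the difference solves the same linear equation, whose skewness preserves the
  -- initial norm zero.
  · have h1 := norm_eq_of_inner_deriv_eq_zero (y := fun τ => (Φ τ p : E3) - R τ p)
      (y' := fun t => cross3Linear (σ (u t)) ((Φ t p : E3) - R t p)) h.pos
      (fun t ht => ((hint p hp t ht).sub (hd p t ht)).congr_deriv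
        (by rw [← cross3Linear_apply, ← cross3Linear_apply, map_sub]))
      (fun t _ => inner_cross3_self _ _) ht
    simp only [h.initial p hp, hR0, sub_self, norm_zero, norm_eq_zero] at h1
    exact sub_eq_zero.1 h1

/-! ### Linear isometries as affine transformations of the sphere. -/

theorem hasFDerivAt_coe_radial (q : S2) :
    HasFDerivAt (fun x : E3 => ((radial x : S2) : E3))
      (ContinuousLinearMap.id ℝ E3 - (innerSL ℝ (q : E3)).smulRight (q : E3)) q := by
  have h0 : (q : E3) ≠ 0 := ne_zero_of_mem_unit_sphere q
  have he : (fun y : E3 => ((radial y : S2) : E3)) =ᶠ[nhds (q : E3)] fun y => ‖y‖⁻¹ • y := by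
    filter_upwards [isOpen_ne.mem_nhds h0] with y hy
    exact coe_radial hy
  have hn : HasFDerivAt (fun x : E3 => ‖x‖) (innerSL ℝ (q : E3)) q := by
    have h1 := (hasStrictFDerivAt_norm_sq (q : E3)).hasFDerivAt.sqrt (by simp)
    simp only [Real.sqrt_sq (norm_nonneg _), norm_coe_S2] at h1
    refine h1.congr_fderiv ?_
    ext x
    simp
  have h2 := ((hasDerivAt_inv (by simp)).comp_hasFDerivAt (q : E3) hn).smul (hasFDerivAt_id (q : E3))
  refine (h2.congr_of_eventuallyEq he).congr_fderiv ?_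
  ext x
  simp
  ring

theorem tangentMapS2_of_isometry {R : E3 ≃ₗᵢ[ℝ] E3} {ψ : S2 → S2} (hψ : ∀ q, (ψ q : E3) = R q)
    {q : S2} {v : E3} (hv : ⟪(q : E3), v⟫ = 0) :
    tangentMapS2 ψ q v = R v := by
  have h : HasFDerivAt (fun x : E3 => (ψ (radial x) : E3)) _ (q : E3) :=
    (R.toContinuousLinearEquiv.hasFDerivAt.comp (q : E3) (hasFDerivAt_coe_radial q)).congr_of_eventuallyEq
      (Filter.Eventually.of_forall fun x => hψ _)
  rw [tangentMapS2, sphereDeriv, h.fderiv]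
  simp [hv]

theorem contMDiff_of_isometry {R : E3 ≃ₗᵢ[ℝ] E3} {ψ : S2 → S2} (hψ : ∀ q, (ψ q : E3) = R q) :
    ContMDiff (𝓡 2) (𝓡 2) ∞ ψ := by
  have : Fact (Module.finrank ℝ E3 = 2 + 1) := ⟨finrank_euclideanSpace_fin⟩
  have hs : ∀ q : S2, R q ∈ Metric.sphere (0 : E3) 1 := fun q => by simp
  have h1 : ψ = Set.codRestrict (fun q : S2 => R q) _ hs := funext fun q => Subtype.ext (hψ q)
  rw [h1]
  exact (R.contDiff.contMDiff.comp (contMDiff_coe_sphere (m := ∞))).codRestrict_sphere hs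

theorem exists_isometry_restrict (R : E3 ≃ₗᵢ[ℝ] E3) : ∃ ψ : S2 → S2, ∀ q, (ψ q : E3) = R q :=
  ⟨fun q => ⟨R q, by simp⟩, fun _ => rfl⟩

/-- A linear isometry commutes with the radial retraction, hence with `sphereDeriv`, and it
intertwines the tangential projections. -/
theorem isLocalAffine_of_isometry {R : E3 ≃ₗᵢ[ℝ] E3} {ψ : S2 → S2} (hψ : ∀ q, (ψ q : E3) = R q)
    {U : Set S2} (hU : IsOpen U) : IsLocalAffine ψ U := by
  obtain ⟨χ, hχ⟩ := exists_isometry_restrict R.symm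
  have hl : ∀ q, χ (ψ q) = q := fun q => Subtype.ext (by rw [hχ, hψ, R.symm_apply_apply])
  have hr : ∀ q, ψ (χ q) = q := fun q => Subtype.ext (by rw [hψ, hχ, R.apply_symm_apply])
  refine ⟨⟨hU, ?_, (contMDiff_of_isometry hψ).contMDiffOn,
    χ, (contMDiff_of_isometry hχ).contMDiffOn, fun q _ => hl q⟩, ?_⟩
  · rw [image_eq_preimage_of_inverse hl hr]
    exact hU.preimage (contMDiff_of_isometry hχ).continuous
  intro X Y X' Y' hX hY q hq
  have hYt : ∀ p ∈ U, Y' (ψ p) = R (Y p) := fun p hp => by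
    rw [← hY.2.2 p hp, tangentMapS2_of_isometry hψ (hY.1.1 p hp)]
  have hXq : X' (ψ q) = R (X q) := by
    rw [← hX.2.2 q hq, tangentMapS2_of_isometry hψ (hX.1.1 q hq)]
  have hq0 : (q : E3) ≠ 0 := ne_zero_of_mem_unit_sphere q
  have he : (fun x : E3 => Y' (radial (R x))) =ᶠ[nhds (q : E3)] R ∘ fun x => Y (radial x) := by
    have h1 : ∀ᶠ x in nhds (q : E3), radial x ∈ U :=
      (continuousAt_radial hq0).eventually_mem (hU.mem_nhds (by rwa [radial_coe]))
    filter_upwards [h1, isOpen_ne.mem_nhds hq0] with x hx hx0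
    have h2 : radial (R x) = ψ (radial x) := Subtype.ext <| by
      rw [hψ, coe_radial hx0, coe_radial (by simpa using hx0)]
      simp
    rw [h2, hYt _ hx, Function.comp_apply]
  have hD : sphereDeriv Y' (ψ q) (R (X q)) = R (sphereDeriv Y q (X q)) := by
    have h1 := he.fderiv_eq (𝕜 := ℝ)
    rw [R.comp_fderiv] at h1
    -- For composition with a linear equivalence the chain rule holds without differentiability of
    -- `Y'`.
    have h2 : fderiv ℝ (fun x : E3 => Y' (radial (R x))) (q : E3) =
        (fderiv ℝ (fun x : E3 => Y' (radial x)) (R q)).comp (R : E3 →L[ℝ] E3) :=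
      R.toContinuousLinearEquiv.comp_right_fderiv (f := fun x : E3 => Y' (radial x))
    rw [h2] at h1
    rw [sphereDeriv, sphereDeriv, hψ]
    exact congrArg (fun A : E3 →L[ℝ] E3 => A (X q)) h1
  rw [nabla, nabla, hXq, hD, tangentMapS2_of_isometry hψ]
  · simp [tangentProj, hψ]
  · rw [tangentProj, inner_sub_right, inner_smul_right, inner_coe_self, mul_one, sub_self]

theorem greatCircle_map (R : E3 ≃ₗᵢ[ℝ] E3) (p v : E3) (t : ℝ) :
    greatCircle (R p) (R v) t = R (greatCircle p v t) := by
  simp [greatCircle]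

theorem exactLinearization_rotationSystem {V : Type*} {σ : V → E3} {u : ℝ → V} {ε : ℝ}
    {U : Set S2} {Φ : ℝ → S2 → S2} (h : (rotationSystem σ).IsVectorErrorRep u ε U Φ) :
    ControlSystem.ExactLinearization u ε U Φ := by
  obtain ⟨R, hd, hn, hΦ⟩ := exists_linear_flow h
  have hψ : ∀ t, ∃ ψ : S2 → S2, t ∈ Ioo (-ε) ε →
      ∃ R' : E3 ≃ₗᵢ[ℝ] E3, (∀ x, R' x = R t x) ∧ ∀ q, (ψ q : E3) = R' q := by
    intro t
    by_cases ht : t ∈ Ioo (-ε) ε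
    · let R' : E3 ≃ₗᵢ[ℝ] E3 := LinearIsometry.toLinearIsometryEquiv ⟨R t, hn t ht⟩ rfl
      obtain ⟨ψ, hψ⟩ := exists_isometry_restrict R'
      exact ⟨ψ, fun _ => ⟨R', fun _ => rfl, hψ⟩⟩
    -- Outside the time interval `ψ t` is arbitrary; derivatives in time only see the open interval.
    · exact ⟨id, fun h => absurd h ht⟩
  choose ψ hψ using hψ
  refine ⟨fun a => cross3Linear (σ a), fun p' hp' => ⟨ψ, fun t ht => ?_, fun v hv t ht => ?_⟩⟩
  · obtain ⟨R', hR', hψt⟩ := hψ t ht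
    have hΦ' : ∀ p ∈ U, (Φ t p : E3) = R' p := fun p hp => by rw [hΦ t ht p hp, hR']
    refine ⟨isLocalAffine_of_isometry hψt h.normal.1,
      Subtype.ext (by rw [hψt, hΦ' p' hp']), fun p hp v hv => ?_⟩
    obtain ⟨γ, hγ, h0, h1, h2, -⟩ := hv
    have hE : IsExp p' v p := ⟨γ, hγ, h0, h1, h2⟩
    rw [tangentMapS2_of_isometry hψt hE.inner_eq_zero]
    refine isExp_of_coe_eq ?_ ?_
    · rw [hΦ' p' hp', R'.inner_map_map, hE.inner_eq_zero]
    · rw [hΦ' p' hp', hΦ' p hp, greatCircle_map, hE.coe_eq]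
  · have hF : ∀ t ∈ Ioo (-ε) ε, tangentMapS2 (ψ t) p' v = R t v := fun t ht => by
      obtain ⟨R', hR', hψt⟩ := hψ t ht
      rw [tangentMapS2_of_isometry hψt hv, hR']
    have h1 : HasDerivAt (fun τ => tangentMapS2 (ψ τ) p' v) (cross3 (σ (u t)) (R t v)) t :=
      (hd v t ht).congr_of_eventuallyEq (by
        filter_upwards [isOpen_Ioo.mem_nhds ht] with τ hτ
        exact hF τ hτ)
    refine ⟨h1.differentiableAt, ?_⟩
    rw [nablaAlong, h1.deriv, hF t ht, cross3Linear_apply]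

theorem linearObserved_rotationSystem {V : Type*} (σ : V → E3) :
    (rotationSystem σ).LinearObserved :=
  fun _ _ _ _ h => Or.inr (exactLinearization_rotationSystem h)

/-! ### Spherical caps are normal neighbourhoods -/

/-- The spherical cap around `p₀` of the points at height more than `c`. -/
def sphericalCap (p₀ : S2) (c : ℝ) : Set S2 := {q | c < ⟪(p₀ : E3), (q : E3)⟫}

theorem isOpen_sphericalCap (p₀ : S2) (c : ℝ) : IsOpen (sphericalCap p₀ c) :=
  isOpen_lt continuous_const (continuous_const.inner continuous_subtype_val)

theorem mem_sphericalCap_self (p₀ : S2) {c : ℝ} (hc : c < 1) : p₀ ∈ sphericalCap p₀ c := by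
  simpa [sphericalCap] using hc

theorem inner_greatCircle_left {p v : E3} (hp : ‖p‖ = 1) (hv : ⟪p, v⟫ = 0) (t : ℝ) :
    ⟪p, greatCircle p v t⟫ = Real.cos (‖v‖ * t) := by
  rw [greatCircle, inner_add_right, inner_smul_right, inner_smul_right, hv,
    real_inner_self_eq_norm_sq, hp]
  simp

theorem IsErr.norm_lt_pi {p₀ p q : S2} {c : ℝ} (hc : 0 ≤ c) {v : E3}
    (h : IsErr (sphericalCap p₀ c) q p v) : ‖v‖ < Real.pi := by
  obtain ⟨γ, hγ, rfl, rfl, -, hU⟩ := h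
  by_contra! hle
  have hpos : 0 < ‖velocity γ 0‖ := Real.pi_pos.trans_le hle
  have h0 := hU 0 ⟨le_rfl, zero_le_one⟩
  -- At this time the geodesic reaches the antipode of its start; two opposite heights cannot both
  -- exceed `c ≥ 0`.
  have h1 := hU (Real.pi / ‖velocity γ 0‖) ⟨by positivity, (div_le_one hpos).2 hle⟩
  simp only [sphericalCap, mem_ofPred_eq] at h0 h1
  rw [hγ.coe_eq, greatCircle, mul_div_cancel₀ _ hpos.ne'] at h1
  simp at h1
  linarith

/-- Below length `π` the cosine determines the length, and then the nonzero sine determines the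
direction. -/
theorem IsErr.eq_of_sphericalCap {p₀ p q : S2} {c : ℝ} (hc : 0 ≤ c) {v w : E3}
    (hv : IsErr (sphericalCap p₀ c) q p v) (hw : IsErr (sphericalCap p₀ c) q p w) : v = w := by
  have hv1 := hv.norm_lt_pi hc
  have hw1 := hw.norm_lt_pi hc
  have hE : ∀ {v}, IsErr (sphericalCap p₀ c) q p v → IsExp p v q := by
    rintro v ⟨γ, hγ, h0, h1, h2, -⟩
    exact ⟨γ, hγ, h0, h1, h2⟩
  have hi : ∀ {v}, IsErr (sphericalCap p₀ c) q p v → ⟪(p : E3), (q : E3)⟫ = Real.cos ‖v‖ := by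
    intro v hv
    rw [(hE hv).coe_eq, inner_greatCircle_left (norm_coe_S2 p) (hE hv).inner_eq_zero, mul_one]
  have hn : ‖v‖ = ‖w‖ := Real.injOn_cos ⟨norm_nonneg _, hv1.le⟩ ⟨norm_nonneg _, hw1.le⟩
    ((hi hv).symm.trans (hi hw))
  have h2 := (hE hv).coe_eq.symm.trans (hE hw).coe_eq
  rw [greatCircle, greatCircle, ← hn, add_right_inj] at h2
  rcases eq_or_ne v 0 with rfl | h0
  · rw [norm_zero] at hn
    exact (norm_eq_zero.1 hn.symm).symm
  · have h3 := norm_pos_iff.2 h0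
    have h4 := Real.sin_pos_of_pos_of_lt_pi h3 hv1
    rw [mul_one] at h2
    exact smul_right_injective E3 (by positivity : Real.sin ‖v‖ * ‖v‖⁻¹ ≠ 0) h2

/-- Points of the minor arc are `a p + b q` with `a, b ≥ 0`, and `a + b ≥ 1` by the triangle
inequality. Their height is therefore at least the smaller height of the endpoints. -/
theorem exists_isErr_sphericalCap {p₀ p q : S2} {c : ℝ} (hc : 0 ≤ c)
    (hp : p ∈ sphericalCap p₀ c) (hq : q ∈ sphericalCap p₀ c) :
    ∃ v, IsErr (sphericalCap p₀ c) q p v := by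
  rcases eq_or_ne p q with rfl | hpq
  · obtain ⟨γ, hγ, h0, h1, h2⟩ := exists_isGeodesic p (v := 0) (by simp)
    have h3 : ∀ t, γ t = p := fun t => Subtype.ext (by simp [h2, greatCircle])
    exact ⟨0, γ, hγ, h0, h1, h3 1, fun s _ => by rwa [h3 s]⟩
  have hp' : c < ⟪(p₀ : E3), (p : E3)⟫ := hp
  have hq' : c < ⟪(p₀ : E3), (q : E3)⟫ := hq
  set C := ⟪(p : E3), (q : E3)⟫ with hC
  have hC1 : C < 1 := (inner_lt_one_iff_real_of_norm_eq_one (norm_coe_S2 p) (norm_coe_S2 q)).2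
    fun h => hpq (Subtype.ext h)
  have hC2 : -1 < C := by
    have h1 : (p : E3) + q ≠ 0 := by
      intro h
      have h2 := congrArg (fun x => ⟪(p₀ : E3), x⟫) h
      simp only [inner_add_right, inner_zero_right] at h2
      linarith
    have h2 : 0 < ‖(p : E3) + q‖ ^ 2 := by positivity
    rw [norm_add_sq_real, norm_coe_S2, norm_coe_S2] at h2
    linarith
  set d := Real.arccos C with hd
  have hcos : Real.cos d = C := Real.cos_arccos hC2.le hC1.le
  have hd0 : 0 < d := Real.arccos_pos.2 hC1
  have hdpi : d < Real.pi := by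
    rw [hd, Real.arccos_lt_pi]
    exact hC2
  have hsin : 0 < Real.sin d := Real.sin_pos_of_pos_of_lt_pi hd0 hdpi
  have hnorm : ‖(q : E3) - C • (p : E3)‖ = Real.sin d := by
    have h1 : ‖(q : E3) - C • (p : E3)‖ ^ 2 = Real.sin d ^ 2 := by
      rw [norm_sub_sq_real, norm_smul, norm_coe_S2, norm_coe_S2, inner_smul_right,
        real_inner_comm, ← hC, Real.sin_sq, hcos]
      simp
      ring
    exact (pow_left_inj₀ (norm_nonneg _) hsin.le two_ne_zero).1 h1
  -- The component of `q` orthogonal to `p` has norm `sin d`; it is rescaled to length `d`, the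
  -- angle between `p` and `q`.
  set v : E3 := (d / Real.sin d) • ((q : E3) - C • (p : E3)) with hv
  have hvn : ‖v‖ = d := by
    rw [hv, norm_smul, hnorm, Real.norm_of_nonneg (by positivity), div_mul_cancel₀ _ hsin.ne']
  have hpv : ⟪(p : E3), v⟫ = 0 := by
    rw [hv, inner_smul_right, inner_sub_right, inner_smul_right, inner_coe_self, ← hC]
    simp
  obtain ⟨γ, hγ, h0, h1, h2⟩ := exists_isGeodesic p hpv
  have h3 : ∀ t, (γ t : E3) = (Real.sin (d - d * t) / Real.sin d) • (p : E3) +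
      (Real.sin (d * t) / Real.sin d) • (q : E3) := by
    intro t
    rw [h2, greatCircle, hvn, hv, smul_smul, smul_sub, smul_smul, Real.sin_sub, hcos]
    have e1 : Real.sin (d * t) * d⁻¹ * (d / Real.sin d) = Real.sin (d * t) / Real.sin d := by
      field_simp
    have e2 : (Real.sin d * Real.cos (d * t) - C * Real.sin (d * t)) / Real.sin d =
      Real.cos (d * t) - Real.sin (d * t) / Real.sin d * C := by
      field_simp
    rw [e1, e2]
    module
  refine ⟨v, γ, hγ, h0, h1, Subtype.ext ?_, fun s hs => ?_⟩
  · rw [h3]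
    simp [hsin.ne']
  · have ha : 0 ≤ Real.sin (d - d * s) / Real.sin d :=
      div_nonneg (Real.sin_nonneg_of_nonneg_of_le_pi (by nlinarith [hs.2])
        (by nlinarith [hs.1])) hsin.le
    have hb : 0 ≤ Real.sin (d * s) / Real.sin d :=
      div_nonneg (Real.sin_nonneg_of_nonneg_of_le_pi (by nlinarith [hs.1])
        (by nlinarith [hs.2])) hsin.le
    have hab := norm_coe_S2 (γ s)
    rw [sphericalCap, mem_ofPred_eq]
    rw [h3] at hab ⊢
    set a := Real.sin (d - d * s) / Real.sin d
    set b := Real.sin (d * s) / Real.sin d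
    have h5 : 1 ≤ a + b := by
      have := norm_add_le (a • (p : E3)) (b • (q : E3))
      rw [hab, norm_smul, norm_smul, norm_coe_S2, norm_coe_S2, Real.norm_of_nonneg ha,
        Real.norm_of_nonneg hb] at this
      linarith
    rw [inner_add_right, inner_smul_right, inner_smul_right]
    set m := min ⟪(p₀ : E3), (p : E3)⟫ ⟪(p₀ : E3), (q : E3)⟫
    have hm : c < m := lt_min hp' hq'
    have h6 := mul_le_mul_of_nonneg_left (min_le_left _ _ : m ≤ ⟪(p₀ : E3), (p : E3)⟫) ha
    have h7 := mul_le_mul_of_nonneg_left (min_le_right _ _ : m ≤ ⟪(p₀ : E3), (q : E3)⟫) hb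
    nlinarith

theorem isNormalNbhd_sphericalCap (p₀ : S2) {c : ℝ} (h0 : 0 ≤ c) (h1 : c < 1) :
    IsNormalNbhd (sphericalCap p₀ c) := by
  refine ⟨isOpen_sphericalCap p₀ c, ⟨p₀, mem_sphericalCap_self p₀ h1⟩, fun p hp q hq => ?_⟩
  obtain ⟨v, hv⟩ := exists_isErr_sphericalCap h0 hp hq
  exact ⟨v, hv, fun w hw => hw.eq_of_sphericalCap h0 hv⟩

/-! ### Local vector-error representations exist -/

theorem IsVectorFieldOn.contDiffAt_comp_radial {W : S2 → E3} (hW : IsVectorFieldOn W univ)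
    {x : E3} (hx : x ≠ 0) : ContDiffAt ℝ ∞ (fun y : E3 => W (radial y)) x :=
  ((contMDiffOn_univ.1 hW.2).contMDiffAt.comp x (contMDiffAt_radial hx)).contDiffAt

theorem IsVectorFieldOn.inner_radial {W : S2 → E3} (hW : IsVectorFieldOn W univ) (x : E3) :
    ⟪x, W (radial x)⟫ = 0 := by
  rcases eq_or_ne x 0 with rfl | hx
  · simp
  · have h := hW.1 (radial x) (mem_univ _)
    rw [coe_radial hx, inner_smul_left] at h
    simpa [hx] using h

/-- Picard–Lindelöf for the radially constant extension of the field gives one `ε` for all starting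
points in a ball. The extension is tangent to all spheres around the origin, so solutions stay on
the unit sphere. -/
theorem ControlSystem.exists_isVectorErrorRep {V : Type*} (f : ControlSystem V) (a : V) (p₀ : S2) :
    ∃ (ε : ℝ) (U : Set S2) (Φ : ℝ → S2 → S2),
      p₀ ∈ U ∧ f.IsVectorErrorRep (fun _ => a) ε U Φ := by
  have hW := f.isVectorField a
  obtain ⟨r, hr, ε, hε, H⟩ := ((hW.contDiffAt_comp_radial
    (ne_zero_of_mem_unit_sphere p₀)).of_le
      (by simp : (1 : WithTop ℕ∞) ≤ ∞)).exists_forall_mem_closedBall_exists_eq_forall_mem_Ioo_hasDerivAt 0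
  rw [zero_sub, zero_add] at H
  -- Since `‖q - p₀‖² = 2 - 2⟪p₀, q⟫`, the second bound keeps the cap in the ball; the first keeps
  -- it in a hemisphere, hence normal.
  set c := max 0 (1 - r ^ 2 / 2)
  have hc1 : c < 1 := max_lt one_pos (by nlinarith)
  have hsub : ∀ q ∈ sphericalCap p₀ c, (q : E3) ∈ Metric.closedBall (p₀ : E3) r := by
    intro q hq
    have h1 : 1 - r ^ 2 / 2 < ⟪(p₀ : E3), (q : E3)⟫ := (le_max_right _ _).trans_lt hq
    rw [mem_closedBall_iff_norm']
    refine abs_le_of_sq_le_sq' ?_ hr.le |>.2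
    rw [norm_sub_sq_real, norm_coe_S2, norm_coe_S2]
    linarith
  have hα : ∀ q : S2, ∃ α : ℝ → E3, q ∈ sphericalCap p₀ c →
      α 0 = q ∧ ∀ t ∈ Ioo (-ε) ε, HasDerivAt α (f.field a (radial (α t))) t := by
    intro q
    by_cases hq : q ∈ sphericalCap p₀ c
    · obtain ⟨α, h1, h2⟩ := H q (hsub q hq)
      exact ⟨α, fun _ => ⟨h1, h2⟩⟩
    · exact ⟨0, fun h => absurd h hq⟩
  choose α hα using hα
  refine ⟨ε, sphericalCap p₀ c, fun t p => radial (α p t), mem_sphericalCap_self p₀ hc1,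
    hε, isNormalNbhd_sphericalCap p₀ (le_max_left _ _) hc1, fun p hp => ?_, fun p hp t ht => ?_⟩
  · simp only [(hα p hp).1, radial_coe]
  · refine ((hα p hp).2 t ht).congr_of_eventuallyEq ?_
    filter_upwards [isOpen_Ioo.mem_nhds ht] with τ hτ
    refine radial_of_norm_eq_one ?_
    rw [norm_eq_of_inner_deriv_eq_zero hε (hα p hp).2 (fun _ _ => hW.inner_radial _) hτ,
      (hα p hp).1, norm_coe_S2]

/-! ### Fields of linear observed systems preserve geodesic midpoints -/

theorem add_greatCircle_one (p v : E3) :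
    p + greatCircle p v 1 = (2 * Real.cos (‖v‖ / 2)) • greatCircle p v (1 / 2) := by
  have h1 : Real.cos ‖v‖ = 2 * Real.cos (‖v‖ / 2) ^ 2 - 1 := by
    rw [← Real.cos_two_mul]; congr 1; ring
  have h2 : Real.sin ‖v‖ = 2 * Real.sin (‖v‖ / 2) * Real.cos (‖v‖ / 2) := by
    rw [← Real.sin_two_mul]; congr 1; ring
  rw [greatCircle, greatCircle, mul_one, mul_one_div, h1, h2]
  module

theorem greatCircle_smul (p v : E3) {r : ℝ} (hr : 0 < r) (t : ℝ) :
    greatCircle p (r • v) t = greatCircle p v (r * t) := by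
  rw [greatCircle, greatCircle, norm_smul, Real.norm_of_nonneg hr.le, smul_smul]
  have h1 : r * ‖v‖ * t = ‖v‖ * (r * t) := by ring
  rw [h1]
  congr 2
  rcases eq_or_ne v 0 with rfl | h0
  · simp
  · have := norm_ne_zero_iff.2 h0
    field_simp

theorem eq_inner_smul_of_eq_smul {x m : E3} {l : ℝ} (hm : ‖m‖ = 1) (h : x = l • m) :
    x = ⟪m, x⟫ • m := by
  rw [h, inner_smul_right, real_inner_self_eq_norm_sq, hm]
  simp

/-- The unknown derivative of the scalar factor is absorbed in `k`; it multiplies the normal vector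
`M t` and later disappears against a tangent vector. Derivatives within `S` cover both the one-sided
time interval of a patch and an open interval. -/
theorem exists_deriv_eq_of_add_eq_smul {P Q M : ℝ → E3} {P' Q' M' : E3} {S : Set ℝ} {t : ℝ}
    (hS : UniqueDiffWithinAt ℝ S t) (ht : t ∈ S) (hP : HasDerivWithinAt P P' S t)
    (hQ : HasDerivWithinAt Q Q' S t) (hM : HasDerivWithinAt M M' S t)
    (h : ∀ s ∈ S, P s + Q s = ⟪M s, P s + Q s⟫ • M s) :
    ∃ k : ℝ, P' + Q' = ⟪M t, P t + Q t⟫ • M' + k • M t :=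
  ⟨_, hS.eq_deriv _ (hP.add hQ) (((hM.inner ℝ (hP.add hQ)).smul hM).congr h (h t ht))⟩

namespace ControlSystem

variable {V : Type*} {f : ControlSystem V} {u : ℝ → V} {ε : ℝ} {U : Set S2} {Φ : ℝ → S2 → S2}

theorem IsVectorErrorRep.zero_mem (h : f.IsVectorErrorRep u ε U Φ) : (0 : ℝ) ∈ Ioo (-ε) ε :=
  ⟨by linarith [h.pos], h.pos⟩

theorem IsVectorErrorRep.hasDerivAt_zero (h : f.IsVectorErrorRep u ε U Φ) {p : S2} (hp : p ∈ U) :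
    HasDerivAt (fun τ => (Φ τ p : E3)) (f.field (u 0) p) 0 := by
  have h1 := h.integral p hp 0 h.zero_mem
  rwa [h.initial p hp] at h1

theorem IsVectorErrorRep.eventually_mem (h : f.IsVectorErrorRep u ε U Φ) {p : S2} (hp : p ∈ U) :
    ∀ᶠ t in nhds (0 : ℝ), Φ t p ∈ U := by
  have h1 : ContinuousAt (fun τ => Φ τ p) 0 :=
    Topology.IsEmbedding.subtypeVal.continuousAt_iff.2 (h.hasDerivAt_zero hp).continuousAt
  exact h1.eventually_mem (h.normal.1.mem_nhds (by rwa [h.initial p hp]))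

/-- By self-similarity the midpoint curve of a patch between the endpoints of `γ` is a flow line. -/
theorem Preintegrable.exists_midpoint (hpre : f.Preintegrable u ε U Φ)
    (h : f.IsVectorErrorRep u ε U Φ) {γ : ℝ → S2} (hγ : IsGeodesic γ)
    (hU : ∀ s ∈ Icc (0 : ℝ) 1, γ s ∈ U) :
    ∃ k : ℝ, f.field (u 0) (γ 0) + f.field (u 0) (γ 1) =
      ⟪(γ (1 / 2) : E3), (γ 0 : E3) + γ 1⟫ • f.field (u 0) (γ (1 / 2)) +
        k • (γ (1 / 2) : E3) := by
  have h0 := hU 0 ⟨le_rfl, zero_le_one⟩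
  have h1 := hU 1 ⟨zero_le_one, le_rfl⟩
  obtain ⟨δ, hδ, hmem⟩ := Metric.eventually_nhds_iff.1
    ((h.eventually_mem h0).and (h.eventually_mem h1))
  have hε := h.pos
  set T := min δ ε / 2
  have hT0 : 0 < T := half_pos (lt_min hδ hε)
  have hTδ : T < δ := (half_lt_self (lt_min hδ hε)).trans_le (min_le_left _ _)
  have hTε : T < ε := (half_lt_self (lt_min hδ hε)).trans_le (min_le_right _ _)
  -- The patch is assembled from geodesics provided by normality, with `γ` itself prescribed at time
  -- zero.
  have hG : ∀ t, ∃ g : ℝ → S2, (t = 0 → g = γ) ∧ (t ∈ Icc 0 T →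
      IsGeodesic g ∧ g 0 = Φ t (γ 0) ∧ g 1 = Φ t (γ 1) ∧ ∀ s ∈ Icc (0 : ℝ) 1, g s ∈ U) := by
    intro t
    rcases eq_or_ne t 0 with rfl | ht0
    · exact ⟨γ, fun _ => rfl, fun _ => ⟨hγ, (h.initial _ h0).symm, (h.initial _ h1).symm, hU⟩⟩
    by_cases ht : t ∈ Icc 0 T
    · have h2 := @hmem t (by
        rw [Real.dist_eq, sub_zero, abs_of_nonneg ht.1]
        exact ht.2.trans_lt hTδ)
      obtain ⟨v, ⟨g, hg, hg0, -, hg1, hgU⟩, -⟩ := h.normal.2.2 _ h2.1 _ h2.2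
      exact ⟨g, fun h => absurd h ht0, fun _ => ⟨hg, hg0, hg1, hgU⟩⟩
    · exact ⟨γ, fun h => absurd h ht0, fun h => absurd h ht⟩
  choose G hG0 hG using hG
  have hpatch : IsPatch U Φ T (γ 1) (γ 0) G := fun t ht =>
    ⟨G t, (hG t ht).1, (hG t ht).2.1, (hG t ht).2.2.1, fun s hs => ⟨(hG t ht).2.2.2 s hs, rfl⟩⟩
  have hm := hpre.1 T ⟨hT0, hTε⟩ _ h1 _ h0 G hpatch (1 / 2) ⟨by norm_num, by norm_num⟩ 0
    ⟨le_rfl, hT0.le⟩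
  rw [hG0 0 rfl] at hm
  obtain ⟨k, hk⟩ := exists_deriv_eq_of_add_eq_smul (uniqueDiffOn_Icc hT0 0 ⟨le_rfl, hT0.le⟩)
    ⟨le_rfl, hT0.le⟩ (h.hasDerivAt_zero h0).hasDerivWithinAt
    (h.hasDerivAt_zero h1).hasDerivWithinAt hm fun t ht => by
      obtain ⟨hg, hg0, hg1, -⟩ := hG t ht
      refine eq_inner_smul_of_eq_smul (norm_coe_S2 _)
        (l := 2 * Real.cos (‖velocity (G t) 0‖ / 2)) ?_
      rw [← hg0, ← hg1, hg.coe_eq 1, hg.coe_eq (1 / 2), add_greatCircle_one]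
  refine ⟨k, ?_⟩
  rw [hG0 0 rfl, h.initial _ h0, h.initial _ h1] at hk
  exact hk

/-- The differential of `ψ t` is linear, so it carries half the error vector to half its image.
Hence `Φ t` carries the midpoint of `γ` to the midpoint of the image geodesic. -/
theorem ExactLinearization.exists_midpoint (hex : ExactLinearization u ε U Φ)
    (h : f.IsVectorErrorRep u ε U Φ) {γ : ℝ → S2} (hγ : IsGeodesic γ)
    (hU : ∀ s ∈ Icc (0 : ℝ) 1, γ s ∈ U) :
    ∃ k : ℝ, f.field (u 0) (γ 0) + f.field (u 0) (γ 1) =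
      ⟪(γ (1 / 2) : E3), (γ 0 : E3) + γ 1⟫ • f.field (u 0) (γ (1 / 2)) +
        k • (γ (1 / 2) : E3) := by
  have h0 := hU 0 ⟨le_rfl, zero_le_one⟩
  have h1 := hU 1 ⟨zero_le_one, le_rfl⟩
  have hh := hU (1 / 2) ⟨by norm_num, by norm_num⟩
  set v := velocity γ 0 with hv
  have hi : ⟪(γ 0 : E3), v⟫ = 0 := hγ.inner_velocity 0
  have he1 : IsErr U (γ 1) (γ 0) v := ⟨γ, hγ, rfl, rfl, rfl, hU⟩
  have he2 : IsErr U (γ (1 / 2)) (γ 0) ((1 / 2 : ℝ) • v) := by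
    obtain ⟨g, hg, hg0, hgv, hgs⟩ := exists_isGeodesic (γ 0) (v := (1 / 2 : ℝ) • v)
      (by rw [inner_smul_right, hi, mul_zero])
    have hgγ : ∀ s, g s = γ (1 / 2 * s) := fun s => Subtype.ext <| by
      rw [hgs, greatCircle_smul _ _ (by norm_num), hγ.coe_eq (1 / 2 * s)]
    refine ⟨g, hg, hg0, hgv, by rw [hgγ, mul_one], fun s hs => ?_⟩
    rw [hgγ]
    exact hU _ ⟨by linarith [hs.1], by linarith [hs.2]⟩
  obtain ⟨B, hB⟩ := hex
  obtain ⟨ψ, hψ, -⟩ := hB _ h0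
  obtain ⟨k, hk⟩ := exists_deriv_eq_of_add_eq_smul (S := Ioo (-ε) ε)
    (isOpen_Ioo.uniqueDiffWithinAt h.zero_mem) h.zero_mem
    (h.hasDerivAt_zero h0).hasDerivWithinAt (h.hasDerivAt_zero h1).hasDerivWithinAt
    (h.hasDerivAt_zero hh).hasDerivWithinAt fun t ht => by
      obtain ⟨-, -, hE⟩ := hψ t ht
      have e1 := (hE _ h1 _ he1).coe_eq
      have e2 := (hE _ hh _ he2).coe_eq
      have e3 : tangentMapS2 (ψ t) (γ 0) ((1 / 2 : ℝ) • v) =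
        (1 / 2 : ℝ) • tangentMapS2 (ψ t) (γ 0) v := map_smul _ _ _
      rw [e3, greatCircle_smul _ _ (by norm_num), mul_one] at e2
      refine eq_inner_smul_of_eq_smul (norm_coe_S2 _)
        (l := 2 * Real.cos (‖tangentMapS2 (ψ t) (γ 0) v‖ / 2)) ?_
      rw [e2, ← add_greatCircle_one, e1]
  refine ⟨k, ?_⟩
  simpa only [h.initial _ h0, h.initial _ h1, h.initial _ hh] using hk

end ControlSystem

/-! ### Midpoint preserving fields are linear -/

/-- A function whose second symmetric differences vanish locally is affine. -/
theorem deriv_eq_of_symmetric_difference {k : ℝ → ℝ} (hk : ContDiff ℝ 2 k)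
    (h : ∀ a, ∃ δ > 0, ∀ s ∈ Ioo 0 δ, k (a + s) + k (a - s) = 2 * k a) (a b : ℝ) :
    deriv k a = deriv k b := by
  have hd : Differentiable ℝ k := hk.differentiable (by simp)
  have hd' : Differentiable ℝ (deriv k) :=
    (contDiff_succ_iff_deriv.1 (show ContDiff ℝ (1 + 1) k from hk)).2.2.differentiable (by simp)
  refine is_const_of_deriv_eq_zero hd' (fun a => ?_) a b
  obtain ⟨δ, hδ, hs⟩ := h a
  have h1 : ∀ᶠ s in nhds (0 : ℝ), k (a + s) + k (a - s) = 2 * k a := by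
    filter_upwards [Ioo_mem_nhds (neg_lt_zero.2 hδ) hδ] with s hsδ
    rcases lt_trichotomy s 0 with h0 | rfl | h0
    · have := hs (-s) ⟨by linarith, by linarith [hsδ.1]⟩
      rw [sub_neg_eq_add, ← sub_eq_add_neg] at this
      linarith
    · simp
      ring
    · exact hs s ⟨h0, hsδ.2⟩
  have h2 : ∀ s, HasDerivAt (fun s => k (a + s) + k (a - s))
      (deriv k (a + s) - deriv k (a - s)) s := fun s =>
    (((hd (a + s)).hasDerivAt.comp_const_add a s).add
      ((hd (a - s)).hasDerivAt.comp_const_sub a s))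
  -- Differentiating this once more at `0` gives `2 k''(a) = 0`.
  have h3 : (fun s => deriv k (a + s) - deriv k (a - s)) =ᶠ[nhds 0] fun _ => 0 := by
    filter_upwards [h1.eventually_nhds] with s hs'
    have h4 : HasDerivAt (fun s => k (a + s) + k (a - s)) 0 s :=
      (hasDerivAt_const s (2 * k a)).congr_of_eventuallyEq hs'
    exact (h2 s).unique h4
  have h5 : HasDerivAt (fun s => deriv k (a + s) - deriv k (a - s))
      (deriv (deriv k) (a + 0) - -deriv (deriv k) (a - 0)) 0 :=
    ((hd' (a + 0)).hasDerivAt.comp_const_add a 0).sub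
      ((hd' (a - 0)).hasDerivAt.comp_const_sub a 0)
  have h6 := h5.unique ((hasDerivAt_const (0 : ℝ) (0 : ℝ)).congr_of_eventuallyEq h3)
  simp only [add_zero, sub_zero] at h6
  linarith

/-- The unit speed circle through `q` in the direction `x`. -/
noncomputable def unitCircle (q x : E3) (s : ℝ) : E3 := Real.cos s • q + Real.sin s • x

/-- Here `unitCircle x (-q)` is the velocity of `unitCircle q x`. -/
theorem unitCircle_add (q x : E3) (a s : ℝ) : unitCircle q x (a + s) =
    Real.cos s • unitCircle q x a + Real.sin s • unitCircle x (-q) a := by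
  simp only [unitCircle, Real.cos_add, Real.sin_add]
  module

theorem ContDiff.unitCircle (q x : E3) : ContDiff ℝ ∞ (unitCircle q x) := by
  unfold _root_.unitCircle
  fun_prop

theorem norm_unitCircle {q x : E3} (hq : ‖q‖ = 1) (hx : ‖x‖ = 1) (hqx : ⟪q, x⟫ = 0) (s : ℝ) :
    ‖unitCircle q x s‖ = 1 := by
  have := norm_greatCircle hq hqx s
  rwa [greatCircle, hx, one_mul, inv_one, mul_one] at this

theorem inner_unitCircle {q x : E3} (hq : ‖q‖ = 1) (hx : ‖x‖ = 1) (hqx : ⟪q, x⟫ = 0) (s : ℝ) :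
    ⟪unitCircle q x s, unitCircle x (-q) s⟫ = 0 := by
  simp only [unitCircle, inner_add_left, inner_add_right, inner_smul_left, inner_smul_right,
    inner_neg_right, real_inner_self_eq_norm_sq, hq, hx, real_inner_comm q x, hqx]
  simp
  ring

/-- The velocity component of a midpoint preserving field is constant along great circles. -/
theorem inner_unitCircle_const {W : S2 → E3} (hW : IsVectorFieldOn W univ)
    (hmid : ∀ p : S2, ∃ U : Set S2, IsOpen U ∧ p ∈ U ∧ ∀ γ : ℝ → S2, IsGeodesic γ →
      (∀ s ∈ Icc (0 : ℝ) 1, γ s ∈ U) → ∃ k : ℝ, W (γ 0) + W (γ 1) =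
        ⟪(γ (1 / 2) : E3), (γ 0 : E3) + γ 1⟫ • W (γ (1 / 2)) + k • (γ (1 / 2) : E3))
    {q x : E3} (hq : ‖q‖ = 1) (hx : ‖x‖ = 1) (hqx : ⟪q, x⟫ = 0) (s : ℝ) :
    ⟪W (radial (unitCircle q x s)), unitCircle x (-q) s⟫ = ⟪W (radial q), x⟫ := by
  have hn := norm_unitCircle hq hx hqx
  have hn' : ∀ s, ‖unitCircle x (-q) s‖ = 1 :=
    norm_unitCircle hx (by rwa [norm_neg]) (by rw [inner_neg_right, real_inner_comm, hqx, neg_zero])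
  have hc := fun s => radial_of_norm_eq_one (hn s)
  have hne : ∀ s, unitCircle q x s ≠ 0 := fun s h0 => by
    have := hn s
    simp [h0] at this
  set k : ℝ → ℝ := fun s => ⟪W (radial (unitCircle q x s)), unitCircle x (-q) s⟫ with hk
  have hkd : ContDiff ℝ 2 k := by
    have h1 : ContDiff ℝ ∞ fun s => W (radial (unitCircle q x s)) :=
      contDiff_iff_contDiffAt.2 fun s =>
        (hW.contDiffAt_comp_radial (hne s)).comp s (ContDiff.unitCircle q x).contDiffAt
    exact contDiff_infty.1 (h1.inner ℝ (ContDiff.unitCircle x (-q))) 2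
  have hdiff : ∀ a, ∃ δ > 0, ∀ s ∈ Ioo 0 δ, k (a + s) + k (a - s) = 2 * k a := by
    intro a
    obtain ⟨U, hU, haU, hUmid⟩ := hmid (radial (unitCircle q x a))
    have hcont : ContinuousAt (fun s => radial (unitCircle q x s)) a :=
      (continuousAt_radial (hne a)).comp (ContDiff.unitCircle q x).continuous.continuousAt
    obtain ⟨δ, hδ, hδU⟩ := Metric.eventually_nhds_iff.1 (hcont.eventually_mem (hU.mem_nhds haU))
    -- The bound `1 < π / 2` keeps `cos s` positive, for the final cancellation.
    refine ⟨min δ 1, lt_min hδ one_pos, fun s hs => ?_⟩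
    have hs0 : 0 < s := hs.1
    have hsδ : s < δ := hs.2.trans_le (min_le_left _ _)
    have hs1 : s < 1 := hs.2.trans_le (min_le_right _ _)
    -- The arc from parameter `a - s` to `a + s`, with midpoint at `a`.
    obtain ⟨γ, hγ, -, -, hγs⟩ := exists_isGeodesic (radial (unitCircle q x (a - s)))
      (v := (2 * s) • unitCircle x (-q) (a - s))
      (by rw [hc, inner_smul_right, inner_unitCircle hq hx hqx, mul_zero])
    have hγe : ∀ t, γ t = radial (unitCircle q x (a - s + 2 * s * t)) := fun t => Subtype.ext <| by
      rw [hγs, hc, hc, greatCircle_smul _ _ (by linarith), unitCircle_add, greatCircle, hn']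
      simp
    obtain ⟨l, hl⟩ := hUmid γ hγ fun t ht => by
      rw [hγe]
      refine hδU ?_
      rw [Real.dist_eq, abs_lt]
      constructor <;> nlinarith [ht.1, ht.2]
    have e0 : γ 0 = radial (unitCircle q x (a - s)) := by rw [hγe]; congr 2; ring
    have e1 : γ 1 = radial (unitCircle q x (a + s)) := by rw [hγe]; congr 2; ring
    have eh : γ (1 / 2) = radial (unitCircle q x a) := by rw [hγe]; congr 2; ring
    rw [e0, e1, eh, hc, hc, hc] at hl
    have hp : unitCircle q x (a + s) =
      Real.cos s • unitCircle q x a + Real.sin s • unitCircle x (-q) a := unitCircle_add q x a s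
    have hm : unitCircle q x (a - s) =
        Real.cos s • unitCircle q x a - Real.sin s • unitCircle x (-q) a := by
      rw [sub_eq_add_neg, unitCircle_add]
      simp [sub_eq_add_neg]
    have hin : ⟪unitCircle q x a, unitCircle q x (a - s) + unitCircle q x (a + s)⟫ =
        2 * Real.cos s := by
      rw [hp, hm]
      simp only [inner_add_right, inner_sub_right, inner_smul_right,
        inner_unitCircle hq hx hqx, real_inner_self_eq_norm_sq, hn]
      ring
    -- In the frame at `a + r`, the velocity at `a` has velocity component `cos r`; its other
    -- component is normal, and `W` does not see it.
    have hcomp : ∀ r, ⟪W (radial (unitCircle q x (a + r))), unitCircle x (-q) a⟫ =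
        Real.cos r * k (a + r) := by
      intro r
      have h1 : unitCircle x (-q) a = Real.cos r • unitCircle x (-q) (a + r) +
          Real.sin r • unitCircle q x (a + r) := by
        have h2 := unitCircle_add x (-q) (a + r) (-r)
        rw [add_neg_cancel_right] at h2
        rw [h2, Real.cos_neg, Real.sin_neg]
        simp only [unitCircle]
        module
      have h3 := hW.1 (radial (unitCircle q x (a + r))) (mem_univ _)
      rw [hc, real_inner_comm] at h3
      rw [h1, inner_add_right, inner_smul_right, inner_smul_right, h3, mul_zero, add_zero]
    have h4 := congrArg (fun y => ⟪y, unitCircle x (-q) a⟫) hl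
    have h5 := hcomp (-s)
    have h6 := hcomp s
    rw [← sub_eq_add_neg, Real.cos_neg] at h5
    simp only [inner_add_left, inner_smul_left, hin, inner_unitCircle hq hx hqx, h5, h6] at h4
    have hcos : 0 < Real.cos s := Real.cos_pos_of_mem_Ioo
      ⟨by linarith [Real.pi_pos], by linarith [Real.pi_gt_three]⟩
    have h7 : Real.cos s * (k (a + s) + k (a - s)) = Real.cos s * (2 * k a) := by
      have h8 : k a = ⟪W (radial (unitCircle q x a)), unitCircle x (-q) a⟫ := rfl
      rw [h8]
      simp at h4
      linarith
    exact mul_left_cancel₀ hcos.ne' h7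
  have hconst := deriv_eq_of_symmetric_difference hkd hdiff
  have haff : ∀ s, k s = k 0 + deriv k 0 * s := by
    intro s
    have h1 : ∀ s, HasDerivAt (fun s => k s - deriv k 0 * s) 0 s := fun s => by
      have h2 := ((hkd.differentiable (by simp)) s).hasDerivAt.sub
        ((hasDerivAt_id s).const_mul (deriv k 0))
      rw [hconst s 0, mul_one, sub_self] at h2
      exact h2
    have h3 := is_const_of_deriv_eq_zero (fun s => (h1 s).differentiableAt)
      (fun s => (h1 s).deriv) s 0
    simp only [mul_zero, sub_zero] at h3
    linarith
  -- Great circles close up, so the affine function `k` has slope zero.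
  have hper : k (2 * Real.pi) = k 0 := by simp [hk, unitCircle]
  have h0 : deriv k 0 = 0 := by
    have h1 := haff (2 * Real.pi)
    rw [hper] at h1
    have h2 : deriv k 0 * (2 * Real.pi) = 0 := by linarith
    exact (mul_eq_zero.1 h2).resolve_right (by positivity)
  have h1 := haff s
  rw [h0, zero_mul, add_zero] at h1
  refine h1.trans ?_
  simp [hk, unitCircle]

/-- If `p = cos d • q + sin d • x`, then `sin d` times the velocity at `p` is `cos d • p - q`.
Tangency turns equality of the velocity components at `p` and `q` into skewness. -/
theorem inner_field_skew {W : S2 → E3} (hW : IsVectorFieldOn W univ)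
    (hconst : ∀ {q x : E3}, ‖q‖ = 1 → ‖x‖ = 1 → ⟪q, x⟫ = 0 → ∀ s : ℝ,
      ⟪W (radial (unitCircle q x s)), unitCircle x (-q) s⟫ = ⟪W (radial q), x⟫) (p q : S2) :
    ⟪W p, (q : E3)⟫ = -⟪W q, (p : E3)⟫ := by
  have htan : ∀ p : S2, ⟪W p, (p : E3)⟫ = 0 := fun p => by
    rw [real_inner_comm]
    exact hW.1 p (mem_univ _)
  set c := ⟪(q : E3), (p : E3)⟫ with hc
  set y : E3 := (p : E3) - c • (q : E3) with hy
  have hqy : ⟪(q : E3), y⟫ = 0 := by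
    rw [hy, inner_sub_right, inner_smul_right, inner_coe_self, ← hc, mul_one, sub_self]
  have hp : (p : E3) = c • (q : E3) + y := by rw [hy]; abel
  have hny : c ^ 2 + ‖y‖ ^ 2 = 1 := by
    have h1 : ‖(p : E3)‖ ^ 2 = 1 := by simp
    rw [hp, norm_add_sq_real, inner_smul_left, hqy, norm_smul, norm_coe_S2] at h1
    simpa using h1
  -- When `p = ± q` no great circle is singled out, but both sides vanish by tangency.
  rcases eq_or_ne y 0 with h0 | h0
  · rw [h0, add_zero] at hp
    have hc0 : c ≠ 0 := fun h => by simp [h, h0] at hny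
    have h1 := htan p
    rw [hp, inner_smul_right] at h1
    rw [(mul_eq_zero.1 h1).resolve_left hc0, hp, inner_smul_right, htan]
    simp
  · have hyn : 0 < ‖y‖ := norm_pos_iff.2 h0
    have hcos : Real.cos (Real.arccos c) = c := Real.cos_arccos (by nlinarith) (by nlinarith)
    have hsin : Real.sin (Real.arccos c) = ‖y‖ := by
      rw [Real.sin_arccos, ← hny, add_sub_cancel_left, Real.sqrt_sq hyn.le]
    have hxy : ‖y‖ • (‖y‖⁻¹ • y) = y := by rw [smul_smul, mul_inv_cancel₀ hyn.ne', one_smul]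
    have h1 := hconst (norm_coe_S2 q) (x := ‖y‖⁻¹ • y) (by simp [norm_smul, h0])
      (by rw [inner_smul_right, hqy, mul_zero]) (Real.arccos c)
    rw [unitCircle, unitCircle, hcos, hsin, hxy, ← hp, radial_coe, radial_coe, inner_add_right,
      inner_smul_right, inner_smul_right, inner_smul_right, inner_smul_right,
      inner_neg_right] at h1
    have h2 : ⟪W p, c • (q : E3) + y⟫ = 0 := by
      rw [← hp]
      exact htan p
    have h3 : ⟪W q, (p : E3)⟫ = ⟪W q, y⟫ := by
      rw [hp, inner_add_right, inner_smul_right, htan, mul_zero, zero_add]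
    rw [inner_add_right, inner_smul_right] at h2
    rw [h3]
    field_simp at h1
    have h4 : (c ^ 2 + ‖y‖ ^ 2) * ⟪W p, (q : E3)⟫ = -⟪W q, y⟫ := by
      linear_combination c * h2 - h1
    rwa [hny, one_mul] at h4

/-- Pairing with the basis vectors gives `(W q)_i = -⟪W (e i), q⟫`, which is linear in `q` with a
skew matrix; its three independent entries form `a`. -/
theorem exists_eq_cross3_of_skew {W : S2 → E3}
    (h : ∀ p q : S2, ⟪W p, (q : E3)⟫ = -⟪W q, (p : E3)⟫) :
    ∃ a : E3, ∀ q : S2, W q = cross3 a q := by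
  let e : Fin 3 → S2 := fun i => ⟨EuclideanSpace.single i 1, by simp⟩
  have hi : ∀ (x : E3) i, ⟪x, (e i : E3)⟫ = x i := fun x i => by
    simp [e, EuclideanSpace.inner_single_right]
  have hs : ∀ i j, W (e i) j = -W (e j) i := fun i j => by rw [← hi, ← hi, h]
  have hd : ∀ i, W (e i) i = 0 := fun i => by linarith [hs i i]
  refine ⟨!₂[W (e 1) 2, -W (e 0) 2, W (e 0) 1], fun q => ?_⟩
  have hq : ∀ i, W q i = -(W (e i) 0 * (q : E3) 0 + W (e i) 1 * (q : E3) 1 +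
      W (e i) 2 * (q : E3) 2) := fun i => by
    rw [← hi, h, PiLp.inner_apply, Fin.sum_univ_three]
    simp [mul_comm]
  ext i
  rw [hq]
  fin_cases i
  · simp [cross3, cross_apply, hd]
    ring
  · simp [cross3, cross_apply, hd, hs 1 0]
    ring
  · simp [cross3, cross_apply, hd, hs 2 0, hs 2 1]

/-- The argument fixes one input value at a time, so `σ` comes from choice, with no relation between
different inputs. -/
theorem exists_eq_rotationSystem_of_linearObserved {V : Type*} {f : ControlSystem V}
    (hf : f.LinearObserved) : ∃ σ : V → E3, f = rotationSystem σ := by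
  have h : ∀ a, ∃ b : E3, ∀ q : S2, f.field a q = cross3 b q := by
    intro a
    have hW := f.isVectorField a
    refine exists_eq_cross3_of_skew (inner_field_skew hW (inner_unitCircle_const hW fun p => ?_))
    obtain ⟨ε, U, Φ, hp, hrep⟩ := f.exists_isVectorErrorRep a p
    refine ⟨U, hrep.normal.1, hp, fun γ hγ hU => ?_⟩
    rcases hf _ ε U Φ hrep with h1 | h1
    · exact h1.exists_midpoint hrep hγ hU
    · exact h1.exists_midpoint hrep hγ hU
  choose σ hσ using h
  refine ⟨σ, ?_⟩
  cases f
  simp only [rotationSystem, ControlSystem.mk.injEq]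
  exact funext fun a => funext fun q => hσ a q

/-! ### Smooth dependence on the input -/

theorem ContDiff.cross3 {E : Type*} [NormedAddCommGroup E] [NormedSpace ℝ E] {g k : E → E3}
    (hg : ContDiff ℝ ∞ g) (hk : ContDiff ℝ ∞ k) :
    ContDiff ℝ ∞ fun x => cross3 (g x) (k x) := by
  have hg' := contDiff_euclidean.1 hg
  have hk' := contDiff_euclidean.1 hk
  refine contDiff_euclidean.2 fun i => ?_
  fin_cases i
  · simpa [_root_.cross3, cross_apply] using ((hg' 1).mul (hk' 2)).sub ((hg' 2).mul (hk' 1))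
  · simpa [_root_.cross3, cross_apply] using ((hg' 2).mul (hk' 0)).sub ((hg' 0).mul (hk' 2))
  · simpa [_root_.cross3, cross_apply] using ((hg' 0).mul (hk' 1)).sub ((hg' 1).mul (hk' 0))

theorem isSmooth_rotationSystem_iff {V : Type*} [NormedAddCommGroup V] [NormedSpace ℝ V]
    (σ : V → E3) : (rotationSystem σ).IsSmooth ↔ ContDiff ℝ ∞ σ := by
  have : Fact (Module.finrank ℝ E3 = 2 + 1) := ⟨finrank_euclideanSpace_fin⟩
  constructor
  · intro h
    have h1 : ∀ q : S2, ContDiff ℝ ∞ fun u => cross3 (σ u) q := fun q =>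
      (ContMDiff.comp (I' := 𝓘(ℝ, V).prod (𝓡 2)) h
        (contMDiff_id.prodMk contMDiff_const : ContMDiff 𝓘(ℝ, V) (𝓘(ℝ, V).prod (𝓡 2)) ∞
          fun u : V => (u, q))).contDiff
    let e : Fin 3 → S2 := fun i => ⟨EuclideanSpace.single i 1, by simp⟩
    have h2 : ∀ i j, ContDiff ℝ ∞ fun u => cross3 (σ u) (e i) j := fun i j =>
      contDiff_euclidean.1 (h1 (e i)) j
    refine contDiff_euclidean.2 fun i => ?_
    fin_cases i
    -- Cyclic indices: the coordinate of `σ × e_j` selected in each case is `σ_i` with sign plus.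
    · simpa [cross3, cross_apply, e] using h2 1 2
    · simpa [cross3, cross_apply, e] using h2 2 0
    · simpa [cross3, cross_apply, e] using h2 0 1
  · intro h
    have h1 : ContDiff ℝ ∞ fun x : V × E3 => cross3 (σ x.1) x.2 :=
      (h.comp contDiff_fst).cross3 contDiff_snd
    have h2 : ContMDiff (𝓘(ℝ, V).prod (𝓡 2)) 𝓘(ℝ, V × E3) ∞
        fun x : V × S2 => (x.1, (x.2 : E3)) :=
      contMDiff_fst.prodMk_space ((contMDiff_coe_sphere (m := ∞)).comp contMDiff_snd)
    exact h1.contMDiff.comp h2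

/-! ### The attitude system and the main theorem. -/

theorem attitudeSystem_eq_rotationSystem : attitudeSystem = rotationSystem fun w => -w := by
  simp only [attitudeSystem, rotationSystem, ControlSystem.mk.injEq]
  funext w q
  simp only [cross3, WithLp.ofLp_neg, map_neg, LinearMap.neg_apply, WithLp.toLp_neg]

theorem mainTheorem6 (V : Type*) [NormedAddCommGroup V] [NormedSpace ℝ V]
    [FiniteDimensional ℝ V] :
    (attitudeSystem.IsSmooth ∧ attitudeSystem.LinearObserved) ∧
    (∀ f : ControlSystem V, f.LinearObserved ↔ ∃ σ : V → E3, f = rotationSystem σ) ∧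
    (∀ σ : V → E3, (rotationSystem σ).IsSmooth ↔ ContDiff ℝ ∞ σ) := by
  refine ⟨?_, fun f => ⟨exists_eq_rotationSystem_of_linearObserved, ?_⟩,
    isSmooth_rotationSystem_iff⟩
  · rw [attitudeSystem_eq_rotationSystem]
    exact ⟨(isSmooth_rotationSystem_iff _).2 contDiff_neg, linearObserved_rotationSystem _⟩
  · rintro ⟨σ, rfl⟩
    exact linearObserved_rotationSystem σ
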